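/- Let $H$ be a finite Heyting algebra. An $H$-algebra is a Heyting algebra $A$ together with a Heyting algebra homomorphism $H\to A$; a morphism of $H$-algebras from $H\to A$ to $H\to A'$ is a Heyting algebra homomorphism $A\to A'$ that commutes with the maps from $H$. An $H$-algebra is called étale if it belongs to the variety generated by $H$ (that is, by $\mathrm{id}\colon H\to H$), the smallest class of $H$-algebras that contains $\mathrm{id}_H$ and is closed under subalgebras, homomorphic images and products. Étale $H$-algebras form a full subcategory $\mathcal{V}(H)$ of the category of $H$-algebras. Then all finite colimits exist in $\mathcal{V}(H)$, and they coincide with the colimits computed in the category $H/\mathbf{DLat}$ of bounded distributive lattices under $H$ (bounded distributive lattices $L$ with a bounded lattice homomorphism $H\to L$, and bounded lattice homomorphisms commuting with the maps from $H$): a cocone under a finite diagram in $\mathcal{V}(H)$ is a colimit cocone in $\mathcal{V}(H)$ if and only if its image under the forgetful functor $\mathcal{V}(H)\to H/\mathbf{DLat}$ is a colimit cocone in $H/\mathbf{DLat}$. -/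

import Mathlib

open CategoryTheory CategoryTheory.Limits

universe u

namespace EtaleHeyting

/-- The category of `H`-algebras: Heyting algebras `A` with a Heyting homomorphism `H → A`, and
Heyting homomorphisms commuting with the structure maps. -/
abbrev HAlg (H : Type u) [HeytingAlgebra H] : Type (u + 1) := Under (HeytAlg.of H)

variable {H : Type u} [HeytingAlgebra H]

/-- The structure map of a product of `H`-algebras, computed coordinatewise. -/
def piStructureMap {I : Type u} (A : I → HAlg H) :
    HeytingHom H (∀ i, (A i).right) where
  toFun h := fun i => (A i).hom.hom h
  map_sup' a b := funext fun i => map_sup (A i).hom.hom a b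
  map_inf' a b := funext fun i => map_inf (A i).hom.hom a b
  map_bot' := funext fun i => map_bot (A i).hom.hom
  map_himp' a b := funext fun i => map_himp (A i).hom.hom a b

/-- The product of a family of `H`-algebras: the product of the underlying Heyting algebras, with
all operations, including the constants from `H`, computed coordinatewise. -/
def piAlg {I : Type u} (A : I → HAlg H) : HAlg H :=
  Under.mk (HeytAlg.ofHom (piStructureMap A) : HeytAlg.of H ⟶ HeytAlg.of (∀ i, (A i).right))

/-- A variety of `H`-algebras: a class of `H`-algebras closed under subalgebras (up to
isomorphism), homomorphic images and products. -/
structure IsVariety (P : ObjectProperty (HAlg H)) : Prop where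
  sub : ∀ {A B : HAlg H} (f : A ⟶ B), Function.Injective f.right → P B → P A
  image : ∀ {A B : HAlg H} (f : A ⟶ B), Function.Surjective f.right → P A → P B
  prod : ∀ {I : Type u} (A : I → HAlg H), (∀ i, P (A i)) → P (piAlg A)

/-- The variety generated by a class `K` of `H`-algebras: the smallest variety containing `K`. -/
def generatedVariety (K : ObjectProperty (HAlg H)) : ObjectProperty (HAlg H) :=
  fun A => ∀ P : ObjectProperty (HAlg H), IsVariety P → K ≤ P → P A

variable (H)

/-- An `H`-algebra is étale if it belongs to the variety generated by `H` itself, that is, by the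
identity map `H → H`. -/
def isEtale : ObjectProperty (HAlg H) :=
  generatedVariety (fun A => A = Under.mk (𝟙 (HeytAlg.of H)))

/-- The category of étale `H`-algebras, a full subcategory of the category of `H`-algebras. -/
abbrev EtaleAlg : Type (u + 1) := (isEtale H).FullSubcategory

/-- The category of (bounded) distributive lattices under `H`: bounded distributive lattices `L`
with a bounded lattice homomorphism `H → L`, and bounded lattice homomorphisms commuting with the
structure maps. -/
abbrev LatUnder : Type (u + 1) := Under (BddDistLat.of H)

/-- The forgetful functor which regards an étale `H`-algebra `H → A` as a homomorphism of bounded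
distributive lattices. -/
abbrev forgetToLat : EtaleAlg H ⥤ LatUnder H :=
  (isEtale H).ι ⋙ Under.post (forget₂ HeytAlg.{u} BddDistLat.{u})

end EtaleHeyting

/-! In `H` every `x` satisfies `⨆ h, (x ⇔ h) = ⊤`, a finite join because `H` is finite. This is an
equation, so it holds in every étale algebra: each element agrees with constants from `H` on the
pieces of a finite cover. On a piece, implication is computed in `H`, so lattice homomorphisms under
`H` preserve it (`hom_himp`) and the forgetful functor is fully faithful.

For colimits, take all compatible families of prime filters on a diagram; these are the points of
the lattice colimit. The prime filter induced on `H` is principal, generated by some `m`, and local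
constancy gives Heyting evaluations of the diagram in the quotient `Set.Iic m`. In the product of
these quotients, the sublattice generated by the images of `H` and the diagram is closed under `⇨`
(`himp_mem_latticeClosure`), hence étale. Prime filters separate elements of a distributive lattice,
so this sublattice is the lattice colimit (`exists_desc`, `colimitHom_ext`). Full faithfulness then
transfers the universal property to étale algebras. -/

namespace EtaleHeyting

open scoped symmDiff

/-! ### Prime filters separate elements of a distributive lattice. -/

section Separation

variable {L : Type*} [DistribLattice L] [BoundedOrder L]

/-- The characteristic map of the complement of a prime ideal. -/
def primeHom (J : Order.Ideal L) (hJ : J.IsPrime) : BoundedLatticeHom L Prop where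
  toFun x := x ∉ J
  map_sup' x y := by
    simp only [Order.Ideal.sup_mem_iff, sup_Prop_eq, eq_iff_iff]
    tauto
  map_inf' x y := by
    simp only [inf_Prop_eq, eq_iff_iff]
    refine ⟨fun h => ⟨fun hx => h (J.lower inf_le_left hx), fun hy => h (J.lower inf_le_right hy)⟩,
      fun h hxy => (hJ.mem_or_mem hxy).elim h.1 h.2⟩
  map_top' := by
    have := hJ.toIsProper
    simpa using Order.Ideal.IsProper.top_notMem hJ.toIsProper
  map_bot' := by simp

/-- Homomorphisms to `Prop` detect the order of a bounded distributive lattice. -/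
theorem le_of_forall_hom_prop {x y : L} (h : ∀ q : BoundedLatticeHom L Prop, q x → q y) :
    x ≤ y := by
  by_contra hxy
  obtain ⟨J, hJ, hyJ, hxJ⟩ := DistribLattice.prime_ideal_of_disjoint_filter_ideal
    (F := Order.PFilter.principal x) (I := Order.Ideal.principal y) (by
      rw [Set.disjoint_left]
      intro z hz hz'
      exact hxy ((Order.PFilter.mem_principal.1 hz).trans (Order.Ideal.mem_principal.1 hz')))
  refine h (primeHom J hJ) (fun hx => Set.disjoint_left.1 hxJ ?_ hx) (hyJ ?_)
  · exact Order.PFilter.mem_principal.2 le_rfl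
  · exact Order.Ideal.mem_principal.2 le_rfl

theorem eq_of_forall_hom_prop {x y : L} (h : ∀ q : BoundedLatticeHom L Prop, q x ↔ q y) :
    x = y :=
  le_antisymm (le_of_forall_hom_prop fun q => (h q).1) (le_of_forall_hom_prop fun q => (h q).2)

end Separation

/-! ### Quotients of a Heyting algebra by principal filters, realised as principal ideals. -/

section Iic

variable {H : Type*} [HeytingAlgebra H]

instance iicHeytingAlgebra (m : H) : HeytingAlgebra (Set.Iic m) :=
  letI : DistribLattice (Set.Iic m) :=
    { (inferInstance : Lattice (Set.Iic m)) with
      le_sup_inf := fun a b c => le_sup_inf (x := (a : H)) (y := b) (z := c) }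
  HeytingAlgebra.ofHImp (fun a b => ⟨m ⊓ ((a : H) ⇨ b), inf_le_left⟩) (by
    rintro ⟨a, ha⟩ ⟨b, hb⟩ ⟨c, hc⟩
    change a ≤ m ⊓ (b ⇨ c) ↔ a ⊓ b ≤ c
    rw [le_inf_iff, le_himp_iff]
    exact ⟨And.right, fun h => ⟨ha, h⟩⟩)

/-- Restriction to a principal ideal, as a homomorphism of Heyting algebras. -/
def infHom (m : H) : HeytingHom H (Set.Iic m) where
  toFun h := ⟨m ⊓ h, inf_le_left⟩
  map_sup' a b := Subtype.ext (inf_sup_left m a b)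
  map_inf' a b := Subtype.ext (inf_inf_distrib_left m a b)
  map_bot' := Subtype.ext (inf_bot_eq m)
  map_himp' a b := Subtype.ext <| by
    change m ⊓ (a ⇨ b) = m ⊓ ((m ⊓ a) ⇨ (m ⊓ b))
    refine le_antisymm (le_inf inf_le_left ?_) (le_inf inf_le_left ?_)
    · rw [le_himp_iff]
      refine le_inf (inf_le_left.trans inf_le_left) ?_
      calc m ⊓ (a ⇨ b) ⊓ (m ⊓ a) ≤ (a ⇨ b) ⊓ a := inf_le_inf inf_le_right inf_le_right
        _ ≤ b := himp_inf_le
    · rw [le_himp_iff]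
      calc m ⊓ (m ⊓ a ⇨ m ⊓ b) ⊓ a ≤ (m ⊓ a ⇨ m ⊓ b) ⊓ (m ⊓ a) :=
            le_inf (inf_le_left.trans inf_le_right)
              (inf_le_inf inf_le_left le_rfl)
        _ ≤ m ⊓ b := himp_inf_le
        _ ≤ b := inf_le_right

@[simp] theorem coe_infHom (m h : H) : (infHom m h : H) = m ⊓ h := rfl

/-- The kernel of `infHom m` is the congruence of the principal filter of `m`. -/
theorem infHom_eq_iff {m h k : H} : infHom m h = infHom m k ↔ m ≤ h ⇔ k := by
  rw [Subtype.ext_iff, coe_infHom, coe_infHom, bihimp_def, le_inf_iff, le_himp_iff, le_himp_iff]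
  constructor
  · intro e
    exact ⟨e.symm.le.trans inf_le_right, e.le.trans inf_le_right⟩
  · rintro ⟨h1, h2⟩
    exact le_antisymm (le_inf inf_le_left h2) (le_inf inf_le_left h1)

theorem infHom_surjective (m : H) : Function.Surjective (infHom m) :=
  fun x => ⟨x, Subtype.ext (inf_eq_right.2 x.2)⟩

end Iic

/-! ### Calculus of `⇔`: agreement on a piece `w`, and finite covers. -/

section Bihimp

variable {A : Type*} [HeytingAlgebra A]

theorem bihimp_inf_le_right (x y : A) : x ⇔ y ⊓ x ≤ y := by
  rw [bihimp_def]
  exact (inf_le_inf_right _ inf_le_right).trans himp_inf_le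

theorem bihimp_inf_le_left (x y : A) : x ⇔ y ⊓ y ≤ x := by
  rw [bihimp_comm]; exact bihimp_inf_le_right y x

theorem le_bihimp_iff' {w x y : A} : w ≤ x ⇔ y ↔ w ⊓ x = w ⊓ y := by
  rw [bihimp_def, le_inf_iff, le_himp_iff, le_himp_iff]
  constructor
  · rintro ⟨h1, h2⟩
    exact le_antisymm (le_inf inf_le_left h2) (le_inf inf_le_left h1)
  · intro e
    exact ⟨e.symm.le.trans inf_le_right, e.le.trans inf_le_right⟩

theorem inf_bihimp_le_sup (x x' y y' : A) : x ⇔ x' ⊓ y ⇔ y' ≤ (x ⊔ y) ⇔ (x' ⊔ y') := by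
  rw [le_bihimp_iff', inf_sup_left, inf_sup_left]
  congr 1
  · exact le_bihimp_iff'.1 inf_le_left
  · exact le_bihimp_iff'.1 inf_le_right

theorem inf_bihimp_le_inf (x x' y y' : A) : x ⇔ x' ⊓ y ⇔ y' ≤ (x ⊓ y) ⇔ (x' ⊓ y') := by
  rw [le_bihimp_iff', inf_inf_distrib_left _ x y, inf_inf_distrib_left _ x' y',
    le_bihimp_iff'.1 (inf_le_left : x ⇔ x' ⊓ y ⇔ y' ≤ _),
    le_bihimp_iff'.1 (inf_le_right : x ⇔ x' ⊓ y ⇔ y' ≤ _)]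

theorem inf_bihimp_le_trans (x y z : A) : x ⇔ y ⊓ y ⇔ z ≤ x ⇔ z :=
  le_bihimp_iff'.2 ((le_bihimp_iff'.1 inf_le_left).trans (le_bihimp_iff'.1 inf_le_right))

/-- Implication is local: its restriction to `w` depends only on the restrictions of its arguments.
-/
theorem inf_himp_eq_of_inf_eq {w x x' y y' : A} (hx : w ⊓ x = w ⊓ x') (hy : w ⊓ y = w ⊓ y') :
    w ⊓ (x ⇨ y) = w ⊓ (x' ⇨ y') := by
  have key : ∀ {x x' y y' : A}, w ⊓ x = w ⊓ x' → w ⊓ y = w ⊓ y' →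
      w ⊓ (x ⇨ y) ≤ w ⊓ (x' ⇨ y') := by
    intro x x' y y' hx hy
    refine le_inf inf_le_left (le_himp_iff.2 ?_)
    calc w ⊓ (x ⇨ y) ⊓ x' = (x ⇨ y) ⊓ (w ⊓ x') := by ac_rfl
      _ = w ⊓ ((x ⇨ y) ⊓ x) := by rw [← hx]; ac_rfl
      _ ≤ w ⊓ y := inf_le_inf_left _ himp_inf_le
      _ = w ⊓ y' := hy
      _ ≤ y' := inf_le_right
  exact le_antisymm (key hx hy) (key hx.symm hy.symm)

theorem inf_bihimp_le_himp (x x' y y' : A) : x ⇔ x' ⊓ y ⇔ y' ≤ (x ⇨ y) ⇔ (x' ⇨ y') :=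
  le_bihimp_iff'.2 (inf_himp_eq_of_inf_eq (le_bihimp_iff'.1 inf_le_left)
    (le_bihimp_iff'.1 inf_le_right))

/-- By distributivity, inequalities can be checked on each piece of a finite cover. -/
theorem le_of_sup_eq_top {ι : Type*} [Fintype ι] {u : ι → A} (hu : Finset.univ.sup u = ⊤)
    {x y : A} (h : ∀ i, u i ⊓ x ≤ y) : x ≤ y := by
  rw [← top_inf_eq x, ← hu, Finset.sup_inf_distrib_right]
  exact Finset.sup_le fun i _ => h i

theorem sup_inf_eq_top {ι κ : Type*} [Fintype ι] [Fintype κ] {u : ι → A} {v : κ → A}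
    (hu : Finset.univ.sup u = ⊤) (hv : Finset.univ.sup v = ⊤) :
    (Finset.univ.sup fun i : ι × κ => u i.1 ⊓ v i.2) = ⊤ := by
  refine top_le_iff.1 (le_of_sup_eq_top hu fun i => le_of_sup_eq_top hv fun j => ?_)
  rw [inf_top_eq, inf_comm]
  exact Finset.le_sup (f := fun i : ι × κ => u i.1 ⊓ v i.2) (Finset.mem_univ (i, j))

end Bihimp

/-! ### Locally constant algebras and their evaluation at prime filters. -/

section LocallyConstant

variable {H : Type*} [HeytingAlgebra H] [Fintype H] {A B : Type*} [HeytingAlgebra A]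
  [HeytingAlgebra B]

/-- An algebra over a finite Heyting algebra `H` is locally constant if it satisfies the equations
`⨆ h, (x ⇔ h) = ⊤`. -/
def IsLocallyConstant (c : HeytingHom H A) : Prop :=
  ∀ x, (Finset.univ.sup fun h => x ⇔ c h) = ⊤

/-- Lattice homomorphisms under `H` between locally constant algebras preserve implication. -/
theorem IsLocallyConstant.hom_himp {c : HeytingHom H A} (hc : IsLocallyConstant c)
    {d : HeytingHom H B} (f : BoundedLatticeHom A B) (hf : ∀ h, f (c h) = d h) (x y : A) :
    f (x ⇨ y) = f x ⇨ f y := by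
  refine le_antisymm ?_ ?_
  · rw [le_himp_iff, ← map_inf]
    exact OrderHomClass.mono f himp_inf_le
  -- On each piece of the common refinement of the two covers, both `x` and `y` are constants; `f`
  -- carries this cover to a cover of `B`.
  · have hu := sup_inf_eq_top (hc x) (hc y)
    have hu' := congrArg f hu
    rw [map_finset_sup, map_top] at hu'
    refine le_of_sup_eq_top hu' ?_
    rintro ⟨h, k⟩
    change f (x ⇔ c h ⊓ y ⇔ c k) ⊓ (f x ⇨ f y) ≤ _
    set w := x ⇔ c h ⊓ y ⇔ c k with hw
    have hx : w ⊓ x = w ⊓ c h := le_bihimp_iff'.1 inf_le_left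
    have hy : w ⊓ y = w ⊓ c k := le_bihimp_iff'.1 inf_le_right
    have hx' : f w ⊓ f x = f w ⊓ d h := by rw [← hf, ← map_inf, ← map_inf, hx]
    have hy' : f w ⊓ f y = f w ⊓ d k := by rw [← hf, ← map_inf, ← map_inf, hy]
    rw [inf_himp_eq_of_inf_eq hx' hy', ← map_himp, ← hf, ← map_inf, map_himp,
      ← inf_himp_eq_of_inf_eq hx hy]
    exact OrderHomClass.mono f inf_le_right

variable {c : HeytingHom H A}

theorem IsLocallyConstant.exists_value (hc : IsLocallyConstant c) (p : BoundedLatticeHom A Prop)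
    (x : A) : ∃ h, p (x ⇔ c h) := by
  by_contra! hn
  have h1 := congrArg p (hc x)
  rw [map_finset_sup, map_top] at h1
  have h2 : Finset.univ.sup (p ∘ fun h => x ⇔ c h) ≤ ⊥ := Finset.sup_le fun h _ => hn h
  exact h2 (h1 ▸ trivial)

/-- A locally constant algebra is evaluated at a prime filter `p` in the quotient of `H` by the
restriction of `p`, which is a principal filter. -/
noncomputable def IsLocallyConstant.value (hc : IsLocallyConstant c) (p : BoundedLatticeHom A Prop)
    (m : H) (x : A) : Set.Iic m :=
  infHom m (hc.exists_value p x).choose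

/-- The value is independent of the choice: if `p` contains `x ⇔ c h` and `x ⇔ c k`, it contains `c
(k ⇔ h)`, so `m ≤ k ⇔ h`. -/
theorem IsLocallyConstant.value_eq (hc : IsLocallyConstant c) {p : BoundedLatticeHom A Prop}
    {m : H} (hm : ∀ h, p (c h) ↔ m ≤ h) {x : A} {h : H} (hx : p (x ⇔ c h)) :
    hc.value p m x = infHom m h := by
  have hk := (hc.exists_value p x).choose_spec
  rw [value, infHom_eq_iff, ← hm, map_bihimp]
  refine OrderHomClass.mono p (inf_bihimp_le_trans _ x _) ?_
  rw [map_inf, bihimp_comm]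
  exact ⟨hk, hx⟩

theorem IsLocallyConstant.value_spec (hc : IsLocallyConstant c) {p : BoundedLatticeHom A Prop}
    {m : H} (hm : ∀ h, p (c h) ↔ m ≤ h) (x : A) :
    ∃ h, p (x ⇔ c h) ∧ hc.value p m x = infHom m h :=
  let ⟨h, hh⟩ := hc.exists_value p x
  ⟨h, hh, hc.value_eq hm hh⟩

/-- Evaluation at a prime filter as a homomorphism of Heyting algebras. -/
noncomputable def IsLocallyConstant.eval (hc : IsLocallyConstant c) {p : BoundedLatticeHom A Prop}
    {m : H} (hm : ∀ h, p (c h) ↔ m ≤ h) : HeytingHom A (Set.Iic m) where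
  toFun := hc.value p m
  map_sup' x y := by
    obtain ⟨h, hh, eh⟩ := hc.value_spec hm x
    obtain ⟨k, hk, ek⟩ := hc.value_spec hm y
    rw [eh, ek, ← map_sup]
    refine hc.value_eq hm (OrderHomClass.mono p (?_ : x ⇔ c h ⊓ y ⇔ c k ≤ _) ?_)
    · rw [map_sup]; exact inf_bihimp_le_sup _ _ _ _
    · rw [map_inf]; exact ⟨hh, hk⟩
  map_inf' x y := by
    obtain ⟨h, hh, eh⟩ := hc.value_spec hm x
    obtain ⟨k, hk, ek⟩ := hc.value_spec hm y
    rw [eh, ek, ← map_inf]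
    refine hc.value_eq hm (OrderHomClass.mono p (?_ : x ⇔ c h ⊓ y ⇔ c k ≤ _) ?_)
    · rw [map_inf]; exact inf_bihimp_le_inf _ _ _ _
    · rw [map_inf]; exact ⟨hh, hk⟩
  map_bot' := by
    rw [hc.value_eq hm (h := ⊥), map_bot]
    rw [map_bot, bihimp_self, map_top]
    trivial
  map_himp' x y := by
    obtain ⟨h, hh, eh⟩ := hc.value_spec hm x
    obtain ⟨k, hk, ek⟩ := hc.value_spec hm y
    rw [eh, ek, ← map_himp]
    refine hc.value_eq hm (OrderHomClass.mono p (?_ : x ⇔ c h ⊓ y ⇔ c k ≤ _) ?_)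
    · rw [map_himp]; exact inf_bihimp_le_himp _ _ _ _
    · rw [map_inf]; exact ⟨hh, hk⟩

theorem IsLocallyConstant.eval_eq (hc : IsLocallyConstant c) {p : BoundedLatticeHom A Prop}
    {m : H} (hm : ∀ h, p (c h) ↔ m ≤ h) {x : A} {h : H} (hx : p (x ⇔ c h)) :
    hc.eval hm x = infHom m h :=
  hc.value_eq hm hx

theorem IsLocallyConstant.eval_const (hc : IsLocallyConstant c) {p : BoundedLatticeHom A Prop}
    {m : H} (hm : ∀ h, p (c h) ↔ m ≤ h) (h : H) : hc.eval hm (c h) = infHom m h :=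
  hc.eval_eq hm (by rw [bihimp_self, map_top]; trivial)

/-- Evaluation loses nothing about `p`, which is recovered as the preimage of `⊤`. -/
theorem IsLocallyConstant.eval_eq_top_iff (hc : IsLocallyConstant c)
    {p : BoundedLatticeHom A Prop} {m : H} (hm : ∀ h, p (c h) ↔ m ≤ h) (x : A) :
    hc.eval hm x = ⊤ ↔ p x := by
  obtain ⟨h, hh, eh⟩ := hc.value_spec hm x
  change hc.value p m x = ⊤ ↔ _
  rw [eh, ← map_top (infHom m), infHom_eq_iff, bihimp_top, ← hm]
  constructor
  · intro hp
    refine OrderHomClass.mono p (bihimp_inf_le_left x (c h)) ?_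
    rw [map_inf]; exact ⟨hh, hp⟩
  · intro hp
    refine OrderHomClass.mono p (bihimp_inf_le_right x (c h)) ?_
    rw [map_inf]; exact ⟨hh, hp⟩

theorem IsLocallyConstant.eval_comp (hc : IsLocallyConstant c) {d : HeytingHom H B}
    (hd : IsLocallyConstant d) (f : HeytingHom A B) (hf : ∀ h, f (c h) = d h)
    {p : BoundedLatticeHom A Prop} {q : BoundedLatticeHom B Prop} (hpq : ∀ x, q (f x) ↔ p x)
    {m : H} (hp : ∀ h, p (c h) ↔ m ≤ h) (hq : ∀ h, q (d h) ↔ m ≤ h) (x : A) :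
    hd.eval hq (f x) = hc.eval hp x := by
  obtain ⟨h, hh, eh⟩ := hc.value_spec hp x
  refine Eq.trans ?_ eh.symm
  refine hd.eval_eq hq ?_
  rw [← hf, ← map_bihimp, hpq]
  exact hh

/-- Every prime filter of a finite lattice is principal. -/
theorem exists_le_iff (r : BoundedLatticeHom H Prop) : ∃ m : H, ∀ h, r h ↔ m ≤ h := by
  classical
  refine ⟨(Finset.univ.filter fun h => r h).inf id, fun h => ⟨fun hh => ?_, fun hh => ?_⟩⟩
  · exact Finset.inf_le (f := id) (by simpa using hh)
  · refine OrderHomClass.mono r hh ?_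
    rw [map_finset_inf]
    have : (⊤ : Prop) ≤ (Finset.univ.filter fun h => r h).inf (r ∘ id) :=
      Finset.le_inf fun k hk _ => (Finset.mem_filter.1 hk).2
    exact this trivial

end LocallyConstant

/-! ### Sublattices closed under implication. -/

section Sublattice

variable {H : Type u} [HeytingAlgebra H] {A : Type*} [HeytingAlgebra A]

/-- `x` agrees with constants on each member of a finite cover by elements of `S`. -/
def IsConstantOnCover (c : HeytingHom H A) (S : Set A) (x : A) : Prop :=
  ∃ (ι : Type u) (_ : Fintype ι) (u : ι → A) (k : ι → H),
    (∀ i, u i ∈ S) ∧ Finset.univ.sup u = ⊤ ∧ ∀ i, u i ≤ x ⇔ c (k i)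

variable {c : HeytingHom H A} {S : Set A}

theorem IsConstantOnCover.map₂ (hS : InfClosed S) {x y : A} (hx : IsConstantOnCover c S x)
    (hy : IsConstantOnCover c S y) {op : A → A → A} {op' : H → H → H}
    (hop : ∀ h k, x ⇔ c h ⊓ y ⇔ c k ≤ op x y ⇔ c (op' h k)) :
    IsConstantOnCover c S (op x y) := by
  obtain ⟨ι, _, u, h, huS, hu, hux⟩ := hx
  obtain ⟨κ, _, v, k, hvS, hv, hvy⟩ := hy
  exact ⟨ι × κ, inferInstance, fun i => u i.1 ⊓ v i.2, fun i => op' (h i.1) (k i.2),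
    fun i => hS (huS _) (hvS _), sup_inf_eq_top hu hv,
    fun i => (inf_le_inf (hux i.1) (hvy i.2)).trans (hop _ _)⟩

theorem IsConstantOnCover.mem (hinf : InfClosed S) (hsup : SupClosed S) (hc : ∀ h, c h ∈ S)
    {x : A} (hx : IsConstantOnCover c S x) : x ∈ S := by
  obtain ⟨ι, _, u, k, huS, hu, hux⟩ := hx
  -- Gluing the constant values over the cover expresses `x` by lattice operations on members of
  -- `S`.
  have : x = Finset.univ.sup fun i => u i ⊓ c (k i) := by
    refine le_antisymm (le_of_sup_eq_top hu fun i => ?_) (Finset.sup_le fun i _ => ?_)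
    · rw [le_bihimp_iff'.1 (hux i)]
      exact Finset.le_sup (f := fun i => u i ⊓ c (k i)) (Finset.mem_univ i)
    · rw [← le_bihimp_iff'.1 (hux i)]
      exact inf_le_right
  rw [this]
  refine Finset.sup_induction (p := (· ∈ S)) ?_ (fun a ha b hb => hsup ha hb)
    fun i _ => hinf (huS i) (hc _)
  rw [← map_bot c]
  exact hc _

/-- A sublattice generated by locally constant families and containing the constants is closed
under implication. -/
theorem himp_mem_latticeClosure {G : Set A} (hc : ∀ h, c h ∈ G)
    (hG : ∀ x ∈ G, IsConstantOnCover c (latticeClosure G) x) {x y : A}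
    (hx : x ∈ latticeClosure G) (hy : y ∈ latticeClosure G) : x ⇨ y ∈ latticeClosure G := by
  have hS := isSublattice_latticeClosure (s := G)
  have key : ∀ z ∈ latticeClosure G, IsConstantOnCover c (latticeClosure G) z := by
    intro z hz
    refine latticeClosure_sup_inf_induction
      (fun z _ => IsConstantOnCover c (latticeClosure G) z) hG ?_ ?_ hz
    · intro a _ b _ ha hb
      exact ha.map₂ hS.infClosed hb (op' := (· ⊔ ·)) fun h k => by
        rw [map_sup]; exact inf_bihimp_le_sup _ _ _ _
    · intro a _ b _ ha hb
      exact ha.map₂ hS.infClosed hb (op' := (· ⊓ ·)) fun h k => by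
        rw [map_inf]; exact inf_bihimp_le_inf _ _ _ _
  refine IsConstantOnCover.mem hS.infClosed hS.supClosed (fun h => subset_latticeClosure (hc h)) ?_
  exact (key x hx).map₂ hS.infClosed (key y hy) (op' := (· ⇨ ·)) fun h k => by
    rw [map_himp]; exact inf_bihimp_le_himp _ _ _ _

theorem IsLocallyConstant.isConstantOnCover [Fintype H] {B : Type*} [HeytingAlgebra B]
    {d : HeytingHom H B} (hd : IsLocallyConstant d) (f : HeytingHom B A)
    (hf : ∀ h, f (d h) = c h) (hS : ∀ x, f x ∈ S) (x : B) : IsConstantOnCover c S (f x) := by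
  refine ⟨H, inferInstance, fun h => f (x ⇔ d h), id, fun h => hS _, ?_, fun h => ?_⟩
  · have := congrArg f (hd x)
    rwa [map_finset_sup, map_top] at this
  · exact (congrArg (f x ⇔ ·) (hf h) ▸ map_bihimp f x (d h)).le

/-- A sublattice of a Heyting algebra which contains `⊤` and `⊥` and is closed under implication
is a Heyting algebra. -/
abbrev sublatticeHeytingAlgebra (S : Sublattice A) (hbot : ⊥ ∈ S) (htop : ⊤ ∈ S)
    (himp : ∀ {x y}, x ∈ S → y ∈ S → x ⇨ y ∈ S) : HeytingAlgebra S :=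
  letI : BoundedOrder S :=
    { top := ⟨⊤, htop⟩
      bot := ⟨⊥, hbot⟩
      le_top := fun x => (le_top : (x : A) ≤ ⊤)
      bot_le := fun x => (bot_le : ⊥ ≤ (x : A)) }
  HeytingAlgebra.ofHImp (fun x y => ⟨(x : A) ⇨ y, himp x.2 y.2⟩)
    fun x y z => (le_himp_iff : (x : A) ≤ (y : A) ⇨ z ↔ _)

end Sublattice

/-! ### Étale algebras are locally constant; full faithfulness of the forgetful functor. -/

section Etale

variable {H : Type u} [HeytingAlgebra H]

theorem isVariety_generatedVariety (K : ObjectProperty (HAlg H)) :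
    IsVariety (generatedVariety K) where
  sub f hf hB P hP hK := hP.sub f hf (hB P hP hK)
  image f hf hA P hP hK := hP.image f hf (hA P hP hK)
  prod A hA P hP hK := hP.prod A fun i => hA i P hP hK

theorem isEtale_id : isEtale H (Under.mk (𝟙 (HeytAlg.of H))) := fun _ _ hK => hK _ rfl

theorem hom_right_apply {A B : HAlg H} (f : A ⟶ B) (h : H) :
    f.right.hom (A.hom.hom h) = B.hom.hom h :=
  congrArg (fun g => HeytAlg.Hom.hom g h) (Under.w f)

theorem isEtale_iic (m : H) :
    isEtale H (Under.mk (HeytAlg.ofHom (infHom m) : HeytAlg.of H ⟶ HeytAlg.of (Set.Iic m))) :=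
  (isVariety_generatedVariety _).image
    (A := Under.mk (𝟙 (HeytAlg.of H)))
    (B := Under.mk (HeytAlg.ofHom (infHom m) : HeytAlg.of H ⟶ HeytAlg.of (Set.Iic m)))
    (Under.homMk (HeytAlg.ofHom (infHom m))) (infHom_surjective m) isEtale_id

theorem forgetToLat_faithful : (forgetToLat H).Faithful where
  map_injective {A B} f g hfg := by
    ext x
    exact congrArg (fun k => BddDistLat.Hom.hom k.right x) hfg

variable [Fintype H]

theorem isVariety_isLocallyConstant :
    IsVariety fun A : HAlg H => IsLocallyConstant A.hom.hom where
  sub {A B} f hf hB x := hf <| by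
    change f.right.hom _ = f.right.hom _
    rw [map_finset_sup, map_top]
    refine Eq.trans (congrArg _ (funext fun h => ?_)) (hB (f.right.hom x))
    rw [← hom_right_apply f]
    exact map_bihimp f.right.hom _ _
  image {A B} f hf hA y := by
    obtain ⟨x, rfl⟩ := hf y
    have := congrArg f.right.hom (hA x)
    rw [map_finset_sup, map_top] at this
    refine Eq.trans (congrArg _ (funext fun h => ?_)) this
    rw [← hom_right_apply f]
    exact (map_bihimp f.right.hom _ _).symm
  prod {I} A hA x := by
    refine funext fun i => ?_
    refine Eq.trans ?_ (hA i (x i))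
    exact Finset.sup_apply _ _ _

/-- The term `h = x` of the join is already `⊤`. -/
theorem isLocallyConstant_id : IsLocallyConstant (HeytingHom.id H) := fun x =>
  top_le_iff.1 <| (bihimp_self x).ge.trans
    (Finset.le_sup (f := fun h => x ⇔ h) (Finset.mem_univ x))

theorem isLocallyConstant_of_isEtale {A : HAlg H} (hA : isEtale H A) :
    IsLocallyConstant A.hom.hom :=
  hA _ isVariety_isLocallyConstant <| by
    rintro _ rfl
    exact isLocallyConstant_id

theorem forgetToLat_full : (forgetToLat H).Full where
  map_surjective {A B} g := by
    let f : BoundedLatticeHom A.obj.right B.obj.right := g.right.hom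
    have hf : ∀ h, f (A.obj.hom.hom h) = B.obj.hom.hom h := fun h =>
      congrArg (fun k => BddDistLat.Hom.hom k h) (Under.w g)
    let φ : HeytingHom A.obj.right B.obj.right :=
      { f.toLatticeHom with
        map_bot' := map_bot f
        map_himp' := (isLocallyConstant_of_isEtale A.property).hom_himp f hf }
    refine ⟨ObjectProperty.homMk (Under.homMk (HeytAlg.ofHom φ) ?_), ?_⟩
    · ext h
      exact hf h
    · ext x
      rfl

end Etale

/-! ### Construction of the colimit inside a product of quotients of `H`. -/

section Colimit

variable {H : Type u} [HeytingAlgebra H] {J : Type} [SmallCategory J] (F : J ⥤ EtaleAlg H)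

/-- A compatible family of prime filters on a diagram of étale algebras and on `H`. -/
structure PrimePoint where
  /-- The prime filter on `H`. -/
  base : BoundedLatticeHom H Prop
  /-- The prime filters on the algebras of the diagram. -/
  fiber : ∀ j, BoundedLatticeHom (F.obj j).obj.right Prop
  fiber_const : ∀ j h, fiber j ((F.obj j).obj.hom.hom h) ↔ base h
  fiber_map : ∀ {i j} (f : i ⟶ j) (x : (F.obj i).obj.right),
    fiber j ((F.map f).hom.right.hom x) ↔ fiber i x

variable {F}

/-- The structure map of a lattice under `H`. -/
abbrev latStructureMap (L : LatUnder H) : BoundedLatticeHom H L.right := L.hom.hom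

/-- The legs of a cocone of lattices under `H`. -/
abbrev latLeg (s : Cocone (F ⋙ forgetToLat H)) (j : J) :
    BoundedLatticeHom (F.obj j).obj.right s.pt.right :=
  (s.ι.app j).right.hom

theorem latLeg_const (s : Cocone (F ⋙ forgetToLat H)) (j : J) (h : H) :
    latLeg s j ((F.obj j).obj.hom.hom h) = latStructureMap s.pt h :=
  congrArg (fun k => BddDistLat.Hom.hom k h) (Under.w (s.ι.app j))

theorem latLeg_map (s : Cocone (F ⋙ forgetToLat H)) {i j : J} (f : i ⟶ j)
    (x : (F.obj i).obj.right) :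
    latLeg s j ((F.map f).hom.right.hom x) = latLeg s i x :=
  congrArg (fun k => BddDistLat.Hom.hom (Under.Hom.right k) x) (s.w f)

/-- The point of the diagram given by a prime filter on the vertex of a cocone of lattices. -/
noncomputable def pointOfCocone (s : Cocone (F ⋙ forgetToLat H)) (q : BoundedLatticeHom s.pt.right Prop) :
    PrimePoint F where
  base := q.comp (latStructureMap s.pt)
  fiber j := q.comp (latLeg s j)
  fiber_const j h := (congrArg q (latLeg_const s j h)).to_iff
  fiber_map f x := (congrArg q (latLeg_map s f x)).to_iff

variable (F) [Fintype H]

namespace PrimePoint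

variable {F}

/-- The generator of the prime filter on `H`. -/
noncomputable def generator (π : PrimePoint F) : H := (exists_le_iff π.base).choose

theorem base_iff (π : PrimePoint F) (h : H) : π.base h ↔ π.generator ≤ h :=
  (exists_le_iff π.base).choose_spec h

theorem fiber_const_iff (π : PrimePoint F) (j : J) (h : H) :
    π.fiber j ((F.obj j).obj.hom.hom h) ↔ π.generator ≤ h :=
  (π.fiber_const j h).trans (π.base_iff h)

/-- The quotient of `H` at a point, as an `H`-algebra. -/
noncomputable def localAlg (π : PrimePoint F) : HAlg H :=
  Under.mk (HeytAlg.ofHom (infHom π.generator) : HeytAlg.of H ⟶ HeytAlg.of (Set.Iic π.generator))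

/-- Evaluation of the algebras in the diagram at a point. -/
noncomputable def eval (π : PrimePoint F) (j : J) :
    HeytingHom (F.obj j).obj.right π.localAlg.right :=
  (isLocallyConstant_of_isEtale (F.obj j).property).eval (π.fiber_const_iff j)

theorem eval_const (π : PrimePoint F) (j : J) (h : H) :
    π.eval j ((F.obj j).obj.hom.hom h) = π.localAlg.hom.hom h :=
  (isLocallyConstant_of_isEtale (F.obj j).property).eval_const (π.fiber_const_iff j) h

theorem eval_eq_top_iff (π : PrimePoint F) (j : J) (x : (F.obj j).obj.right) :
    π.eval j x = ⊤ ↔ π.fiber j x :=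
  (isLocallyConstant_of_isEtale (F.obj j).property).eval_eq_top_iff (π.fiber_const_iff j) x

theorem eval_map (π : PrimePoint F) {i j : J} (f : i ⟶ j) (x : (F.obj i).obj.right) :
    π.eval j ((F.map f).hom.right.hom x) = π.eval i x :=
  (isLocallyConstant_of_isEtale (F.obj i).property).eval_comp
    (isLocallyConstant_of_isEtale (F.obj j).property) (F.map f).hom.right.hom
    (hom_right_apply (F.map f).hom) (π.fiber_map f) _ _ x

theorem localAlg_hom_eq_top_iff (π : PrimePoint F) (h : H) :
    π.localAlg.hom.hom h = ⊤ ↔ π.base h := by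
  rw [π.base_iff]
  change infHom π.generator h = ⊤ ↔ _
  rw [← map_top (infHom π.generator), infHom_eq_iff, bihimp_top]

/-- The top of the quotient is join-prime because the filter on `H` being collapsed is prime. Hence
`d ↦ (d π = ⊤)` preserves joins. -/
theorem sup_eq_top_iff (π : PrimePoint F) (x y : π.localAlg.right) :
    x ⊔ y = ⊤ ↔ x = ⊤ ∨ y = ⊤ := by
  obtain ⟨h, rfl⟩ := infHom_surjective π.generator x
  obtain ⟨k, rfl⟩ := infHom_surjective π.generator y
  have e := π.localAlg_hom_eq_top_iff (h ⊔ k)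
  rw [map_sup, map_sup] at e
  exact e.trans (or_congr (π.localAlg_hom_eq_top_iff h) (π.localAlg_hom_eq_top_iff k)).symm

theorem bot_ne_top (π : PrimePoint F) : (⊥ : π.localAlg.right) ≠ ⊤ := by
  intro h
  rw [← map_bot π.localAlg.hom.hom] at h
  have := (π.localAlg_hom_eq_top_iff ⊥).1 h
  rwa [map_bot] at this

end PrimePoint

/-- The product of the quotients of `H` at all points of the diagram. -/
noncomputable abbrev ambientAlg : HAlg H := piAlg fun π : PrimePoint F => π.localAlg

theorem isEtale_ambientAlg : isEtale H (ambientAlg F) :=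
  (isVariety_generatedVariety _).prod _ fun π => isEtale_iic π.generator

/-- The map from an algebra of the diagram to the product of the quotients of `H`. -/
noncomputable def toAmbient (j : J) : HeytingHom (F.obj j).obj.right (ambientAlg F).right where
  toFun x π := π.eval j x
  map_sup' x y := funext fun π => map_sup (π.eval j) x y
  map_inf' x y := funext fun π => map_inf (π.eval j) x y
  map_bot' := funext fun π => map_bot (π.eval j)
  map_himp' x y := funext fun π => map_himp (π.eval j) x y

theorem toAmbient_const (j : J) (h : H) :
    toAmbient F j ((F.obj j).obj.hom.hom h) = (ambientAlg F).hom.hom h :=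
  funext fun π => π.eval_const j h

theorem toAmbient_map {i j : J} (f : i ⟶ j) (x : (F.obj i).obj.right) :
    toAmbient F j ((F.map f).hom.right.hom x) = toAmbient F i x :=
  funext fun π => π.eval_map f x

/-- The images of `H` and of the algebras of the diagram in the product of the quotients of `H`. -/
def generators : Set (ambientAlg F).right :=
  Set.range (ambientAlg F).hom.hom ∪ ⋃ j, Set.range (toAmbient F j)

theorem const_mem_generators (h : H) : (ambientAlg F).hom.hom h ∈ generators F :=
  Or.inl ⟨h, rfl⟩

theorem toAmbient_mem_generators (j : J) (x : (F.obj j).obj.right) :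
    toAmbient F j x ∈ generators F :=
  Or.inr (Set.mem_iUnion.2 ⟨j, x, rfl⟩)

/-- The sublattice generated by the images of `H` and of the algebras of the diagram. -/
def colimitSublattice : Sublattice (ambientAlg F).right :=
  ⟨latticeClosure (generators F), isSublattice_latticeClosure.supClosed,
    isSublattice_latticeClosure.infClosed⟩

theorem const_mem (h : H) : (ambientAlg F).hom.hom h ∈ colimitSublattice F :=
  subset_latticeClosure (const_mem_generators F h)

theorem toAmbient_mem (j : J) (x : (F.obj j).obj.right) :
    toAmbient F j x ∈ colimitSublattice F :=
  subset_latticeClosure (toAmbient_mem_generators F j x)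

noncomputable instance colimitHeytingAlgebra : HeytingAlgebra (colimitSublattice F) :=
  sublatticeHeytingAlgebra (colimitSublattice F)
    (map_bot (ambientAlg F).hom.hom ▸ const_mem F ⊥)
    (map_top (ambientAlg F).hom.hom ▸ const_mem F ⊤)
    (himp_mem_latticeClosure (c := (ambientAlg F).hom.hom) (const_mem_generators F) (by
      rintro _ (⟨h, rfl⟩ | hx)
      · exact isLocallyConstant_id.isConstantOnCover (ambientAlg F).hom.hom (fun _ => rfl)
          (const_mem F) h
      · obtain ⟨j, x, rfl⟩ := Set.mem_iUnion.1 hx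
        exact (isLocallyConstant_of_isEtale (F.obj j).property).isConstantOnCover
          (toAmbient F j) (toAmbient_const F j) (toAmbient_mem F j) x))

/-- The inclusion of the generated sublattice, as a homomorphism of Heyting algebras. -/
noncomputable def colimitInclusion : HeytingHom (colimitSublattice F) (ambientAlg F).right where
  toFun x := x
  map_sup' _ _ := rfl
  map_inf' _ _ := rfl
  map_bot' := rfl
  map_himp' _ _ := rfl

/-- A Heyting homomorphism to the product with values in the generated sublattice. -/
noncomputable def colimitLift {A : Type*} [HeytingAlgebra A]
    (f : HeytingHom A (ambientAlg F).right) (hf : ∀ x, f x ∈ colimitSublattice F) :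
    HeytingHom A (colimitSublattice F) where
  toFun x := ⟨f x, hf x⟩
  map_sup' x y := Subtype.ext (map_sup f x y)
  map_inf' x y := Subtype.ext (map_inf f x y)
  map_bot' := Subtype.ext (map_bot f)
  map_himp' x y := Subtype.ext (map_himp f x y)

/-- The colimit of the diagram, as an `H`-algebra. -/
noncomputable def colimitAlg : HAlg H :=
  Under.mk (HeytAlg.ofHom (colimitLift F (ambientAlg F).hom.hom (const_mem F)) :
    HeytAlg.of H ⟶ HeytAlg.of (colimitSublattice F))

theorem isEtale_colimitAlg : isEtale H (colimitAlg F) :=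
  (isVariety_generatedVariety _).sub (A := colimitAlg F) (B := ambientAlg F)
    (Under.homMk (HeytAlg.ofHom (colimitInclusion F))) Subtype.val_injective
    (isEtale_ambientAlg F)

/-- The colimit cocone of a diagram of étale algebras. -/
noncomputable def etaleCocone : Cocone F where
  pt := ⟨colimitAlg F, isEtale_colimitAlg F⟩
  ι :=
    { app := fun j => ObjectProperty.homMk
        (Under.homMk (HeytAlg.ofHom (colimitLift F (toAmbient F j) (toAmbient_mem F j))) (by
          ext h
          exact Subtype.ext (toAmbient_const F j h)))
      naturality := fun i j f => by
        ext x
        exact Subtype.ext (toAmbient_map F f x) }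

variable {F}

/-- The image of `d` in the vertex of `s` is prescribed by the prime filters `q` containing it. Such
an element exists for generators, and the condition is stable under `⊔` and `⊓`; uniqueness comes
from `eq_of_forall_hom_prop`. -/
theorem exists_desc (s : Cocone (F ⋙ forgetToLat H)) {d : (ambientAlg F).right}
    (hd : d ∈ colimitSublattice F) :
    ∃ l : s.pt.right, ∀ q, q l ↔ d (pointOfCocone s q) = ⊤ := by
  refine latticeClosure_sup_inf_induction
    (fun d _ => ∃ l : s.pt.right, ∀ q, q l ↔ d (pointOfCocone s q) = ⊤) ?_ ?_ ?_ hd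
  · rintro _ (⟨h, rfl⟩ | hx)
    · exact ⟨latStructureMap s.pt h, fun q =>
        ((pointOfCocone s q).localAlg_hom_eq_top_iff h).symm⟩
    · obtain ⟨j, x, rfl⟩ := Set.mem_iUnion.1 hx
      exact ⟨latLeg s j x, fun q => ((pointOfCocone s q).eval_eq_top_iff j x).symm⟩
  · rintro a _ b _ ⟨l, hl⟩ ⟨k, hk⟩
    refine ⟨l ⊔ k, fun q => ?_⟩
    rw [map_sup]
    exact (or_congr (hl q) (hk q)).trans (PrimePoint.sup_eq_top_iff _ _ _).symm
  · rintro a _ b _ ⟨l, hl⟩ ⟨k, hk⟩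
    refine ⟨l ⊓ k, fun q => ?_⟩
    rw [map_inf]
    exact (and_congr (hl q) (hk q)).trans inf_eq_top_iff.symm

/-- The underlying map of the morphism out of the colimit induced by a cocone of lattices. -/
noncomputable def descFun (s : Cocone (F ⋙ forgetToLat H)) (d : colimitSublattice F) :
    s.pt.right :=
  (exists_desc s d.2).choose

theorem descFun_iff (s : Cocone (F ⋙ forgetToLat H)) (d : colimitSublattice F)
    (q : BoundedLatticeHom s.pt.right Prop) :
    q (descFun s d) ↔ d.1 (pointOfCocone s q) = ⊤ :=
  (exists_desc s d.2).choose_spec q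

/-- The lattice homomorphism out of the colimit induced by a cocone of lattices. -/
noncomputable def descHom (s : Cocone (F ⋙ forgetToLat H)) :
    BoundedLatticeHom (colimitSublattice F) s.pt.right where
  toFun := descFun s
  map_sup' a b := eq_of_forall_hom_prop fun q => by
    rw [map_sup, descFun_iff]
    exact (PrimePoint.sup_eq_top_iff _ _ _).trans
      (or_congr (descFun_iff s a q) (descFun_iff s b q)).symm
  map_inf' a b := eq_of_forall_hom_prop fun q => by
    rw [map_inf, descFun_iff]
    exact inf_eq_top_iff.trans (and_congr (descFun_iff s a q) (descFun_iff s b q)).symm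
  map_top' := eq_of_forall_hom_prop fun q => by
    rw [map_top, descFun_iff]
    exact iff_of_true rfl trivial
  map_bot' := eq_of_forall_hom_prop fun q => by
    rw [map_bot, descFun_iff]
    exact iff_of_false (PrimePoint.bot_ne_top _) id

theorem descHom_const (s : Cocone (F ⋙ forgetToLat H)) (h : H) :
    descHom s ⟨_, const_mem F h⟩ = latStructureMap s.pt h :=
  eq_of_forall_hom_prop fun q => (descFun_iff s _ q).trans
    ((pointOfCocone s q).localAlg_hom_eq_top_iff h)

theorem descHom_leg (s : Cocone (F ⋙ forgetToLat H)) (j : J) (x : (F.obj j).obj.right) :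
    descHom s ⟨_, toAmbient_mem F j x⟩ = latLeg s j x :=
  eq_of_forall_hom_prop fun q => (descFun_iff s _ q).trans
    ((pointOfCocone s q).eval_eq_top_iff j x)

theorem colimitHom_ext {L : Type*} [DistribLattice L] [BoundedOrder L]
    {f g : BoundedLatticeHom (colimitSublattice F) L}
    (hconst : ∀ h, f ⟨_, const_mem F h⟩ = g ⟨_, const_mem F h⟩)
    (hleg : ∀ j x, f ⟨_, toAmbient_mem F j x⟩ = g ⟨_, toAmbient_mem F j x⟩) : f = g := by
  ext ⟨d, hd⟩
  refine latticeClosure_sup_inf_induction (fun d hd => f ⟨d, hd⟩ = g ⟨d, hd⟩) ?_ ?_ ?_ hd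
  · rintro _ (⟨h, rfl⟩ | hx)
    · exact hconst h
    · obtain ⟨j, x, rfl⟩ := Set.mem_iUnion.1 hx
      exact hleg j x
  · intro a ha b hb hfa hfb
    have e : f (⟨a, ha⟩ ⊔ ⟨b, hb⟩ : colimitSublattice F) = _ := map_sup f _ _
    rw [hfa, hfb, ← map_sup] at e
    exact e
  · intro a ha b hb hfa hfb
    have e : f (⟨a, ha⟩ ⊓ ⟨b, hb⟩ : colimitSublattice F) = _ := map_inf f _ _
    rw [hfa, hfb, ← map_inf] at e
    exact e

variable (F)

/-- The cocone of étale algebras is a colimit of lattices under `H`. -/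
noncomputable def isColimitMapEtaleCocone :
    IsColimit ((forgetToLat H).mapCocone (etaleCocone F)) where
  desc s := Under.homMk (BddDistLat.ofHom (descHom s)) (by
    ext h
    exact descHom_const s h)
  fac s j := by
    ext x
    exact descHom_leg s j x
  uniq s m hm := by
    have : (m.right.hom : BoundedLatticeHom (colimitSublattice F) s.pt.right) = descHom s :=
      colimitHom_ext
        (fun h => (congrArg (fun k => BddDistLat.Hom.hom k h) (Under.w m)).trans
          (descHom_const s h).symm)
        (fun j x => (congrArg (fun k => BddDistLat.Hom.hom (Under.Hom.right k) x) (hm j)).trans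
          (descHom_leg s j x).symm)
    ext x
    exact congrArg (fun k => k x) this

end Colimit

end EtaleHeyting

theorem mainTheorem2 (H : Type u) [HeytingAlgebra H] [Finite H] :
    HasFiniteColimits (EtaleHeyting.EtaleAlg H) ∧
    PreservesFiniteColimits (EtaleHeyting.forgetToLat H) ∧
    ReflectsFiniteColimits (EtaleHeyting.forgetToLat H) := by
  obtain ⟨_⟩ := nonempty_fintype H
  have := EtaleHeyting.forgetToLat_faithful (H := H)
  have := EtaleHeyting.forgetToLat_full (H := H)
  have isColimit {J : Type} [SmallCategory J] (F : J ⥤ EtaleHeyting.EtaleAlg H) :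
      IsColimit (EtaleHeyting.etaleCocone F) :=
    isColimitOfReflects (EtaleHeyting.forgetToLat H) (EtaleHeyting.isColimitMapEtaleCocone F)
  refine ⟨⟨fun J _ _ => ⟨fun F => ⟨⟨⟨_, isColimit F⟩⟩⟩⟩⟩, ⟨fun J _ _ => ⟨fun {F} => ?_⟩⟩,
    inferInstance⟩
  -- Colimit cocones are unique up to isomorphism, so preserving this one suffices.
  exact preservesColimit_of_preserves_colimit_cocone (isColimit F)
    (EtaleHeyting.isColimitMapEtaleCocone F)
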